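/- A trigraph $T$ consists of a finite vertex set $V(T)$ and a function $\theta$ assigning to each pair of distinct vertices a value in $\{-1,0,1\}$; the pair is a strong antiedge, a switchable pair or a strong edge if the value is $-1$, $0$ or $1$, respectively. Two distinct vertices are adjacent if $\theta\in\{0,1\}$ and antiadjacent if $\theta\in\{-1,0\}$; $N(v)$ is the set of vertices adjacent to $v$. The complement of $T$ has the same vertices and the function $-\theta$. $T$ is monogamous if every vertex is in at most one switchable pair. A strong clique is a set of pairwise strongly adjacent vertices; an independent set is a set of pairwise antiadjacent vertices; a strong independent set is a set of pairwise strongly antiadjacent vertices. A homogeneous set is a set $S\subseteq V(T)$ with $1<|S|<|V(T)|$ such that every vertex outside $S$ is strongly adjacent to all of $S$ or strongly antiadjacent to all of $S$. Let $\mathcal T_0$ be the class of monogamous trigraphs on at most $8$ vertices. Let $\mathcal T_1$ be the class of monogamous trigraphs whose vertex set can be partitioned into (possibly empty) sets $X,K_1,\dots,K_t$ such that no three vertices of $X$ are pairwise adjacent, $K_1,\dots,K_t$ are strong cliques, any two vertices in different sets $K_i,K_j$ are strongly antiadjacent, and (i) each vertex of $X$ has neighbours in at most two of the sets $K_1,\dots,K_t$;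 (ii) for each $K\in\{K_1,\dots,K_t\}$, the vertices of $K$ can be ordered $v_1,\dots,v_r$ and the set of vertices outside $K$ with a neighbour in $K$ can be partitioned into two strong independent sets $A,B$ such that $A\cap N(v_{i+1})\subseteq A\cap N(v_i)$ and $B\cap N(v_i)\subseteq B\cap N(v_{i+1})$ for $1\le i<r$. A trigraph is basic if it is in $\mathcal T_0$, in $\mathcal T_1$, or is the complement of a trigraph in $\mathcal T_1$. In a weighted monogamous trigraph, every vertex and every switchable pair has a weight in $\mathbb N$. The weight of an independent set $S$ is the sum of the weights of the switchable pairs contained in $S$ and of the weights of the vertices of $S$ that are in no switchable pair contained in $S$; $\alpha(T)$ is the maximum weight of an independent set of $T$. Let $g(x)=\binom{x+1}{2}-1$. Lemma. There is an $O(n^4m)$-time algorithm with the following specifications. Input: a weighted monogamous basic trigraph $T$ on $n$ vertices with $m$ strong edges and with no homogeneous set, in which all vertices have weight at least $1$ and all switchable pairs have weight at least $2$, and a positive integer $k$. Output: one of the following statements, which is true for the input: 1. $n\le 5g(k)$; 2. $T$ has at most $n^3$ (inclusionwise) maximal independent sets; 3. $\alpha(T)\ge k$. Here the running time is the number of steps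 of a single unit-cost random access machine program with addition, truncated subtraction and comparison of natural numbers, the trigraph being given by its adjacency matrix, and it is at most $C(n^4m+1)$ for an absolute constant $C$. -/

import Mathlib

/-- A trigraph on the vertex set `V`: every pair of distinct vertices gets a value in `{-1, 0, 1}`.
The values on the diagonal carry no information and are fixed to be `0`. -/
structure Trigraph (V : Type*) where
  θ : V → V → SignType
  symm : ∀ u v, θ u v = θ v u
  diag : ∀ v, θ v v = 0

/-- Weights on the vertices and on the switchable pairs of a trigraph. The values of `pair`
on pairs that are not switchable are never used. -/
structure TrigraphWeight (V : Type*) where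
  vertex : V → ℕ
  pair : Sym2 V → ℕ

namespace Trigraph

variable {V : Type*} (T : Trigraph V)

/-- `uv` is a strong edge. -/
def StrongAdj (u v : V) : Prop := u ≠ v ∧ T.θ u v = 1

/-- `uv` is a strong antiedge. -/
def StrongAnti (u v : V) : Prop := u ≠ v ∧ T.θ u v = -1

/-- `uv` is a switchable pair. -/
def Semi (u v : V) : Prop := u ≠ v ∧ T.θ u v = 0

/-- Adjacent: a strong edge or a switchable pair. -/
def Adj (u v : V) : Prop := u ≠ v ∧ T.θ u v ≠ -1

/-- Antiadjacent: a strong antiedge or a switchable pair. -/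
def AntiAdj (u v : V) : Prop := u ≠ v ∧ T.θ u v ≠ 1

/-- The graph whose edges are the strong edges of `T`. -/
def strongGraph : SimpleGraph V where
  Adj := T.StrongAdj
  symm := ⟨fun u v h => ⟨h.1.symm, (T.symm v u).trans h.2⟩⟩
  loopless := ⟨fun _ h => h.1 rfl⟩

/-- The graph whose edges are the switchable pairs of `T`. -/
def semiGraph : SimpleGraph V where
  Adj := T.Semi
  symm := ⟨fun u v h => ⟨h.1.symm, (T.symm v u).trans h.2⟩⟩
  loopless := ⟨fun _ h => h.1 rfl⟩

/-- The number of strong edges. -/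
noncomputable def numStrongEdges : ℕ := T.strongGraph.edgeSet.ncard

/-- The complement trigraph. -/
def compl : Trigraph V where
  θ u v := -T.θ u v
  symm u v := by rw [T.symm]
  diag v := by rw [T.diag]; rfl

/-- Every vertex belongs to at most one switchable pair. -/
def Monogamous : Prop := ∀ u v w, T.Semi u v → T.Semi u w → v = w

/-- Pairwise strongly adjacent vertices. -/
def IsStrongClique (S : Finset V) : Prop := ∀ u ∈ S, ∀ v ∈ S, u ≠ v → T.StrongAdj u v

/-- Pairwise antiadjacent vertices (switchable pairs are allowed). -/
def IsIndep (S : Finset V) : Prop := ∀ u ∈ S, ∀ v ∈ S, u ≠ v → T.AntiAdj u v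

/-- Pairwise strongly antiadjacent vertices. -/
def IsStrongIndep (S : Finset V) : Prop := ∀ u ∈ S, ∀ v ∈ S, u ≠ v → T.StrongAnti u v

/-- No three vertices of `S` are pairwise adjacent (switchable pairs count as adjacent). -/
def TriangleFreeOn (S : Finset V) : Prop :=
  ∀ u ∈ S, ∀ v ∈ S, ∀ w ∈ S, ¬ (T.Adj u v ∧ T.Adj v w ∧ T.Adj u w)

/-- Every vertex of `A` is strongly antiadjacent to every vertex of `B`. -/
def StronglyAnticomplete (A B : Finset V) : Prop := ∀ a ∈ A, ∀ b ∈ B, T.StrongAnti a b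

/-- A set with more than one vertex, but not all vertices, such that each vertex outside it is
strongly complete or strongly anticomplete to it. -/
def IsHomogeneousSet [Fintype V] (S : Finset V) : Prop :=
  1 < S.card ∧ S.card < Fintype.card V ∧
    ∀ v, v ∉ S → (∀ x ∈ S, T.StrongAdj v x) ∨ (∀ x ∈ S, T.StrongAnti v x)

/-- The set of neighbours of a vertex. -/
def nbrs (v : V) : Set V := {x | T.Adj v x}

/-- The neighbourhood of a set of vertices: the vertices outside it with a neighbour in it. -/
def setNbrs (S : Finset V) : Set V := {x | x ∉ S ∧ ∃ v ∈ S, T.Adj v x}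

/-- The neighbourhood of `K` is a bipartite trigraph with a bipartition `(A, B)`, and the vertices
of `K` can be listed as `v 0, v 1, …` so that the sets `A ∩ N(v i)` decrease
and the sets `B ∩ N(v i)` increase with `i`. -/
def NestedNbrs (K : Finset V) : Prop :=
  ∃ (v : Fin K.card ≃ K) (A B : Finset V),
    Disjoint A B ∧ (A : Set V) ∪ (B : Set V) = T.setNbrs K ∧
    T.IsStrongIndep A ∧ T.IsStrongIndep B ∧
    Antitone (fun i => (A : Set V) ∩ T.nbrs (v i : V)) ∧
    Monotone (fun i => (B : Set V) ∩ T.nbrs (v i : V))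

/-- A partition of the vertex set into `X` and `K 0, …, K (t - 1)` (possibly empty sets)
as required in the definition of the class `𝒯₁`. -/
structure IsT1Partition (X : Finset V) {t : ℕ} (K : Fin t → Finset V) : Prop where
  cover : ∀ v, v ∈ X ∨ ∃ i, v ∈ K i
  disjoint_left : ∀ i, Disjoint X (K i)
  disjoint : ∀ i j, i ≠ j → Disjoint (K i) (K j)
  triangleFree : T.TriangleFreeOn X
  strongClique : ∀ i, T.IsStrongClique (K i)
  anticomplete : ∀ i j, i ≠ j → T.StronglyAnticomplete (K i) (K j)
  atMostTwo : ∀ x ∈ X, {i : Fin t | ∃ v ∈ K i, T.Adj x v}.ncard ≤ 2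
  nested : ∀ i, T.NestedNbrs (K i)

/-- The class `𝒯₀`: monogamous trigraphs on at most 8 vertices. -/
def InT0 [Fintype V] : Prop := T.Monogamous ∧ Fintype.card V ≤ 8

/-- The class `𝒯₁`. -/
def InT1 : Prop :=
  T.Monogamous ∧ ∃ (X : Finset V) (t : ℕ) (K : Fin t → Finset V), T.IsT1Partition X K

/-- Basic trigraphs: members of `𝒯₀`, of `𝒯₁`, and complements of members of `𝒯₁`. -/
def IsBasic [Fintype V] : Prop := T.InT0 ∨ T.InT1 ∨ T.compl.InT1

/-- The number of inclusionwise maximal independent sets. -/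
noncomputable def numMaximalIndep : ℕ := {S : Finset V | Maximal T.IsIndep S}.ncard

open Classical in
/-- The weight of a set `S` of vertices of a monogamous trigraph: each switchable pair contained in
`S` contributes its own weight, and each other vertex of `S` its vertex weight. -/
noncomputable def weight (w : TrigraphWeight V) (S : Finset V) : ℕ :=
  (∑ v ∈ S with ¬ ∃ u ∈ S, T.Semi v u, w.vertex v) +
    ∑ e ∈ S.sym2 with e ∈ T.semiGraph.edgeSet, w.pair e

open Classical in
/-- The maximum weight of an independent set. -/
noncomputable def alpha [Fintype V] (w : TrigraphWeight V) : ℕ :=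
  ({S : Finset V | T.IsIndep S} : Finset (Finset V)).sup (T.weight w)

end Trigraph

/-! A random access machine with unit cost. A program uses finitely many registers and finitely many
one-dimensional arrays of unbounded length, all holding natural numbers. The arithmetic operations
are addition and truncated subtraction only. -/

namespace RAM

/-- The contents of the registers and of the arrays. -/
structure State where
  reg : ℕ → ℕ
  arr : ℕ → ℕ → ℕ

/-- `s.setReg r x` is `s` with register `r` set to `x`. -/
def State.setReg (s : State) (r x : ℕ) : State :=
  { s with reg := Function.update s.reg r x }

/-- `s.setArr a p x` is `s` with cell `p` of array `a` set to `x`. -/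
def State.setArr (s : State) (a p x : ℕ) : State :=
  { s with arr := Function.update s.arr a (Function.update (s.arr a) p x) }

/-- Comparisons of two registers. -/
inductive Test where
  | lt (a b : ℕ)
  | eq (a b : ℕ)

/-- Whether a comparison succeeds in a given state. -/
def Test.Holds : Test → State → Prop
  | .lt a b, s => s.reg a < s.reg b
  | .eq a b, s => s.reg a = s.reg b

/-- Elementary instructions. -/
inductive Instr where
  /-- register `r` gets the constant `c` -/
  | const (r c : ℕ)
  /-- register `r` gets the content of register `a` -/
  | copy (r a : ℕ)
  /-- register `r` gets the sum of registers `a` and `b` -/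
  | add (r a b : ℕ)
  /-- register `r` gets the truncated difference of registers `a` and `b` -/
  | sub (r a b : ℕ)
  /-- register `r` gets the cell of array `x` whose index is in register `a` -/
  | load (r x a : ℕ)
  /-- the cell of array `x` whose index is in register `a` gets the content of register `b` -/
  | store (x a b : ℕ)

/-- The effect of an elementary instruction. -/
def Instr.run : Instr → State → State
  | .const r c, s => s.setReg r c
  | .copy r a, s => s.setReg r (s.reg a)
  | .add r a b, s => s.setReg r (s.reg a + s.reg b)
  | .sub r a b, s => s.setReg r (s.reg a - s.reg b)
  | .load r x a, s => s.setReg r (s.arr x (s.reg a))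
  | .store x a b, s => s.setArr x (s.reg a) (s.reg b)

/-- Programs. -/
inductive Prog where
  | skip
  | instr (i : Instr)
  | seq (p q : Prog)
  | ite (c : Test) (p q : Prog)
  | while (c : Test) (p : Prog)

/-- `Exec p s t s'`: the program `p`, started in state `s`, halts in state `s'` after `t` steps.
Every elementary instruction and every evaluation of a test is one step. -/
inductive Exec : Prog → State → ℕ → State → Prop where
  | skip (s : State) : Exec .skip s 0 s
  | instr (i : Instr) (s : State) : Exec (.instr i) s 1 (i.run s)
  | seq {p q : Prog} {s s₁ s₂ : State} {t₁ t₂ : ℕ} :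
      Exec p s t₁ s₁ → Exec q s₁ t₂ s₂ → Exec (.seq p q) s (t₁ + t₂) s₂
  | ite_true {c : Test} {p q : Prog} {s s₁ : State} {t : ℕ} :
      c.Holds s → Exec p s t s₁ → Exec (.ite c p q) s (t + 1) s₁
  | ite_false {c : Test} {p q : Prog} {s s₁ : State} {t : ℕ} :
      ¬ c.Holds s → Exec q s t s₁ → Exec (.ite c p q) s (t + 1) s₁
  | while_false {c : Test} {p : Prog} {s : State} :
      ¬ c.Holds s → Exec (.while c p) s 1 s
  | while_true {c : Test} {p : Prog} {s s₁ s₂ : State} {t₁ t₂ : ℕ} :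
      c.Holds s → Exec p s t₁ s₁ → Exec (.while c p) s₁ t₂ s₂ →
      Exec (.while c p) s (t₁ + t₂ + 1) s₂

end RAM

namespace Trigraph

/-- The code of an entry of the adjacency matrix:
`0` strong antiedge, `1` switchable pair (and diagonal), `2` strong edge. -/
def code : SignType → ℕ
  | .neg => 0
  | .zero => 1
  | .pos => 2

open Classical in
/-- The initial state of the machine on the weighted trigraph `(T, w)` with vertices
`0, …, n - 1` and the integer `k`: register `0` holds `n`, register `1` holds `k`; array `0` holds
the adjacency matrix row by row, array `1` the vertex weights, and array `2`, row by row,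
the matrix with the weights of the switchable pairs. Everything else is `0`. -/
noncomputable def inputState {n : ℕ} (T : Trigraph (Fin n)) (w : TrigraphWeight (Fin n)) (k : ℕ) :
    RAM.State where
  reg r := if r = 0 then n else if r = 1 then k else 0
  arr a p :=
    if a = 0 then
      if h : p < n * n then code (T.θ (Fin.divNat ⟨p, h⟩) (Fin.modNat ⟨p, h⟩)) else 0
    else if a = 1 then
      if h : p < n then w.vertex ⟨p, h⟩ else 0
    else if a = 2 then
      if h : p < n * n then
        if T.Semi (Fin.divNat ⟨p, h⟩) (Fin.modNat ⟨p, h⟩) then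
          w.pair s(Fin.divNat ⟨p, h⟩, Fin.modNat ⟨p, h⟩) else 0
      else 0
    else 0

/-- The function `g(x) = (x+1 choose 2) - 1`. -/
def g (x : ℕ) : ℕ := (x + 1).choose 2 - 1

/-- The statement that the output number `o` stands for; any number other
than `1`, `2`, `3` is not a valid output. -/
def OutputTrue {n : ℕ} (T : Trigraph (Fin n)) (w : TrigraphWeight (Fin n)) (k : ℕ) (o : ℕ) : Prop :=
  (o = 1 ∧ n ≤ 5 * g k) ∨ (o = 2 ∧ T.numMaximalIndep ≤ n ^ 3) ∨ (o = 3 ∧ k ≤ T.alpha w)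

end Trigraph

/-! The algorithm searches for a private quadruple: four pairwise antiadjacent vertices, each with a
strong neighbour that is strongly adjacent to none of the other three.

If there is none, every maximal independent set `S` is determined by at most three of its vertices.
Take a minimal `D ⊆ S` strongly dominating the complement of `S`. By minimality each vertex of `D`
has a private strong neighbour, so `D` has at most three elements, and `S` is the set of vertices
with no strong neighbour in `D`. This gives at most `n ^ 3` sets (`numMaximalIndep_le`).

If there is one, `T` is not the complement of a member of `𝒯₁` (`not_hasPrivateQuad_of_compl`). When
`n > 5 * g k` and `k ≥ 2`, we have `n > 10`, so `T` is not in `𝒯₀` and must lie in `𝒯₁`. Suppose `α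
< k` there. Then `X` has at most `g k` vertices and fewer than `k` of the cliques are nonempty.
Absence of homogeneous sets bounds each clique by its neighbourhood, up to one extra vertex and its
vertices in switchable pairs. Summation gives `n ≤ 5 * g k`, a contradiction (`le_alpha_of_inT1`).

The search takes five nested loops, hence `O(n ^ 5)` steps. Without homogeneous sets `n ≤ 4 * m`
once `n ≥ 3` (`card_le_four_mul_numStrongEdges`), which turns this into `O(n ^ 4 * m)`. -/

namespace Trigraph

section Combinatorics

variable {V : Type*} {T : Trigraph V}

/-! ### Adjacency in a trigraph and in its complement -/

lemma StrongAdj.symm {u v : V} (h : T.StrongAdj u v) : T.StrongAdj v u :=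
  ⟨h.1.symm, (T.symm v u).trans h.2⟩

lemma StrongAnti.symm {u v : V} (h : T.StrongAnti u v) : T.StrongAnti v u :=
  ⟨h.1.symm, (T.symm v u).trans h.2⟩

lemma Semi.symm {u v : V} (h : T.Semi u v) : T.Semi v u :=
  ⟨h.1.symm, (T.symm v u).trans h.2⟩

lemma Adj.symm {u v : V} (h : T.Adj u v) : T.Adj v u :=
  ⟨h.1.symm, by rw [T.symm]; exact h.2⟩

lemma strongAdj_or_semi_or_strongAnti {u v : V} (h : u ≠ v) :
    T.StrongAdj u v ∨ T.Semi u v ∨ T.StrongAnti u v := by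
  unfold StrongAdj Semi StrongAnti
  rcases T.θ u v <;> simp [h]

lemma antiAdj_iff {u v : V} (h : u ≠ v) : T.AntiAdj u v ↔ ¬ T.StrongAdj u v := by
  simp [AntiAdj, StrongAdj, h]

lemma compl_adj_iff {u v : V} (h : u ≠ v) : T.compl.Adj u v ↔ ¬ T.StrongAdj u v := by
  have : ∀ a : SignType, -a = -1 ↔ a = 1 := by decide
  simp [Adj, StrongAdj, h, compl, this]

lemma compl_strongAnti_iff {u v : V} : T.compl.StrongAnti u v ↔ T.StrongAdj u v := by
  have : ∀ a : SignType, -a = -1 ↔ a = 1 := by decide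
  simp [StrongAnti, StrongAdj, compl, this]

lemma compl_strongAdj_iff {u v : V} : T.compl.StrongAdj u v ↔ T.StrongAnti u v := by
  have : ∀ a : SignType, -a = 1 ↔ a = -1 := by decide
  simp [StrongAnti, StrongAdj, compl, this]

/-! ### Private quadruples and maximal independent sets -/

/-- Four pairwise antiadjacent vertices, each with a strong neighbour that is
antiadjacent to the other three. -/
def HasPrivateQuad (T : Trigraph V) : Prop :=
  ∃ d : Fin 4 → V, (∀ i j, ¬ T.StrongAdj (d i) (d j)) ∧
    ∀ i, ∃ y, T.StrongAdj y (d i) ∧ ∀ j, j ≠ i → ¬ T.StrongAdj y (d j)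

/-- In the complement the four vertices are pairwise adjacent, so at most two lie in `X` and the
others share one clique `K q`. Their private neighbours lie in `X`. Two vertices in `X` then form a
triangle with such a private neighbour; three in `K q` contradict nestedness at the middle one. -/
lemma not_hasPrivateQuad_of_compl (h : T.compl.InT1) : ¬ T.HasPrivateQuad := by
  classical
  rintro ⟨d, hd, hy⟩
  obtain ⟨-, X, t, K, hP⟩ := h
  choose y hy1 hy2 using hy
  have hinj : ∀ i j, i ≠ j → d i ≠ d j := by
    intro i j hij e
    exact hy2 i j hij.symm (e ▸ hy1 i)
  have tri : ∀ a ∈ X, ∀ b ∈ X, ∀ c ∈ X, a ≠ b → b ≠ c → a ≠ c → ¬ T.StrongAdj a b →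
      ¬ T.StrongAdj b c → ¬ T.StrongAdj a c → False := by
    intro a ha b hb c hc h1 h2 h3 h4 h5 h6
    exact hP.triangleFree a ha b hb c hc
      ⟨(compl_adj_iff h1).2 h4, (compl_adj_iff h2).2 h5, (compl_adj_iff h3).2 h6⟩
  set J : Finset (Fin 4) := {i | d i ∉ X} with hJ
  set I : Finset (Fin 4) := {i | d i ∈ X} with hI
  have hIJ : I.card + J.card = 4 := by
    rw [hI, hJ, Finset.card_filter_add_card_filter_not]; rfl
  have hI2 : I.card ≤ 2 := by
    by_contra! hlt
    obtain ⟨a, b, c, ha, hb, hc, h1, h2, h3⟩ := Finset.two_lt_card_iff.1 hlt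
    simp only [hI, Finset.mem_filter, Finset.mem_univ, true_and] at ha hb hc
    exact tri _ ha _ hb _ hc (hinj _ _ h1) (hinj _ _ h3) (hinj _ _ h2) (hd _ _) (hd _ _) (hd _ _)
  obtain ⟨i₀, hi₀⟩ : J.Nonempty := Finset.card_pos.1 (by omega)
  simp only [hJ, Finset.mem_filter, Finset.mem_univ, true_and] at hi₀
  obtain ⟨q, hq₀⟩ := (hP.cover (d i₀)).resolve_left hi₀
  have hq : ∀ i ∈ J, d i ∈ K q := by
    intro i hi
    simp only [hJ, Finset.mem_filter, Finset.mem_univ, true_and] at hi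
    obtain ⟨p, hp⟩ := (hP.cover (d i)).resolve_left hi
    by_cases hpq : p = q
    · exact hpq ▸ hp
    · exact absurd (compl_strongAnti_iff.1 (hP.anticomplete p q hpq _ hp _ hq₀)) (hd _ _)
  -- In `K q`, `y i` would be strongly antiadjacent to `d i` in `T`; in another clique it would be
  -- strongly adjacent to a second `d j` in `K q`.
  have hyX : ∀ i ∈ J, y i ∈ X := by
    intro i hi
    by_contra hX
    obtain ⟨p, hp⟩ := (hP.cover (y i)).resolve_left hX
    obtain ⟨j, hj, hji⟩ := Finset.exists_mem_ne (show 1 < J.card by omega) i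
    by_cases hpq : p = q
    · subst hpq
      have := compl_strongAdj_iff.1 (hP.strongClique p _ hp _ (hq i hi) (hy1 i).1)
      have h2 := (hy1 i).2
      rw [this.2] at h2
      exact absurd h2 (by decide)
    · exact hy2 i j hji (compl_strongAnti_iff.1 (hP.anticomplete p q hpq _ hp _ (hq j hj)))
  have hne : ∀ i j, y i ≠ d j := fun i j e => hd j i (e ▸ hy1 i)
  by_cases hJ2 : J.card = 2
  · obtain ⟨a, ha, b, hb, hab⟩ := Finset.one_lt_card.1 (show 1 < I.card by omega)
    obtain ⟨i, hi⟩ : J.Nonempty := Finset.card_pos.1 (by omega)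
    simp only [hI, Finset.mem_filter, Finset.mem_univ, true_and] at ha hb
    have hi' := hi
    simp only [hJ, Finset.mem_filter, Finset.mem_univ, true_and] at hi'
    exact tri _ (hyX i hi) _ ha _ hb (hne _ _) (hinj _ _ hab) (hne _ _)
      (hy2 _ _ fun e => hi' (e ▸ ha)) (hd _ _) (hy2 _ _ fun e => hi' (e ▸ hb))
  · obtain ⟨v, A, B, -, hAB, -, -, hA, hB⟩ := hP.nested q
    -- Outside `J` the position is a dummy value.
    have hpos : ∀ i, ∃ p, i ∈ J → (v p : V) = d i := by
      intro i
      by_cases hi : i ∈ J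
      · exact ⟨v.symm ⟨d i, hq i hi⟩, fun _ => by simp⟩
      · exact ⟨v.symm ⟨d i₀, hq₀⟩, fun h => absurd h hi⟩
    choose pos hpos using hpos
    have hJne : J.Nonempty := Finset.card_pos.1 (by omega)
    obtain ⟨a, ha, hamin⟩ := Finset.exists_min_image J pos hJne
    obtain ⟨c, hc, hcmax⟩ := Finset.exists_max_image J pos hJne
    -- In the nested order `b` lies between `a` and `c`. In the complement `y b` sees `a` and `c`
    -- but not `b`, violating monotonicity whether it is in `A` or in `B`.
    obtain ⟨b, hb, hbac⟩ : ∃ b ∈ J, b ∉ ({a, c} : Finset (Fin 4)) := by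
      apply Finset.exists_mem_notMem_of_card_lt_card
      have := Finset.card_le_two (a := a) (b := c)
      omega
    simp only [Finset.mem_insert, Finset.mem_singleton, not_or] at hbac
    have nadj : ∀ j, j ≠ b → T.compl.Adj (d j) (y b) := fun j hj =>
      (compl_adj_iff (hne b j).symm).2 fun h => hy2 b j hj h.symm
    have hbadj : ¬ T.compl.Adj (d b) (y b) := fun h =>
      (compl_adj_iff (hne b b).symm).1 h (hy1 b).symm
    have hmem : y b ∈ T.compl.setNbrs (K q) :=
      ⟨fun h => Finset.disjoint_left.1 (hP.disjoint_left q) (hyX b hb) h,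
        d a, hq a ha, nadj a (Ne.symm hbac.1)⟩
    rw [← hAB] at hmem
    rcases hmem with hmem | hmem
    · have : y b ∈ (A : Set V) ∩ T.compl.nbrs (v (pos b) : V) := hA (hcmax b hb) (show y b ∈ (A : Set V) ∩ T.compl.nbrs (v (pos c) : V) from
        ⟨hmem, by rw [hpos c hc]; exact nadj c (Ne.symm hbac.2)⟩)
      rw [hpos b hb] at this
      exact hbadj this.2
    · have : y b ∈ (B : Set V) ∩ T.compl.nbrs (v (pos b) : V) := hB (hamin b hb) (show y b ∈ (B : Set V) ∩ T.compl.nbrs (v (pos a) : V) from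
        ⟨hmem, by rw [hpos a ha]; exact nadj a (Ne.symm hbac.1)⟩)
      rw [hpos b hb] at this
      exact hbadj this.2

/-- The triple lists a minimum-size strongly dominating subset `D` of `S`. Four elements of `D` with
their private neighbours would be a private quadruple. -/
lemma exists_triple_of_maximal [Fintype V] [Nonempty V] (hT : ¬ T.HasPrivateQuad) {S : Finset V}
    (hS : Maximal T.IsIndep S) :
    ∃ p : V × V × V, ∀ v, v ∈ S ↔
      ¬ T.StrongAdj v p.1 ∧ ¬ T.StrongAdj v p.2.1 ∧ ¬ T.StrongAdj v p.2.2 := by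
  classical
  have hnadj : ∀ v ∈ S, ∀ u ∈ S, ¬ T.StrongAdj v u := by
    intro v hv u hu h
    exact (antiAdj_iff h.1).1 (hS.prop v hv u hu h.1) h
  have hdom : ∀ v, v ∉ S → ∃ u ∈ S, T.StrongAdj v u := by
    intro v hv
    by_contra! hno
    have hind : T.IsIndep (insert v S) := by
      intro a ha b hb hab
      rw [antiAdj_iff hab]
      rcases Finset.mem_insert.1 ha with rfl | ha' <;> rcases Finset.mem_insert.1 hb with rfl | hb'
      · exact absurd rfl hab
      · exact hno b hb'
      · exact fun h => hno a ha' h.symm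
      · exact hnadj a ha' b hb'
    exact hv (hS.le_of_ge hind (Finset.subset_insert v S) (Finset.mem_insert_self v S))
  let F : Finset (Finset V) := {D ∈ S.powerset | ∀ v, v ∉ S → ∃ u ∈ D, T.StrongAdj v u}
  obtain ⟨D, hDF, hmin⟩ := Finset.exists_min_image F Finset.card
    ⟨S, by simp only [F, Finset.mem_filter, Finset.mem_powerset]; exact ⟨subset_rfl, hdom⟩⟩
  simp only [F, Finset.mem_filter, Finset.mem_powerset] at hDF hmin
  obtain ⟨hDS, hD⟩ := hDF
  have hpriv : ∀ d ∈ D, ∃ y, T.StrongAdj y d ∧ ∀ u ∈ D, u ≠ d → ¬ T.StrongAdj y u := by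
    intro d hd
    by_contra! hno
    have := hmin (D.erase d) ⟨(Finset.erase_subset _ _).trans hDS, fun v hv => by
      obtain ⟨u, hu, hvu⟩ := hD v hv
      by_cases hud : u = d
      · obtain ⟨x, hx, hxd, hvx⟩ := hno v (hud ▸ hvu)
        exact ⟨x, Finset.mem_erase.2 ⟨hxd, hx⟩, hvx⟩
      · exact ⟨u, Finset.mem_erase.2 ⟨hud, hu⟩, hvu⟩⟩
    exact absurd (Finset.card_erase_lt_of_mem hd) (by omega)
  have hcard : D.card ≤ 3 := by
    by_contra! hlt
    obtain ⟨D', hD', hc⟩ := Finset.exists_subset_card_eq (show 4 ≤ D.card from hlt)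
    let e := (Finset.equivFinOfCardEq hc).symm
    refine hT ⟨fun i => (e i : V), fun i j => hnadj _ (hDS (hD' (e i).2)) _ (hDS (hD' (e j).2)),
      fun i => ?_⟩
    obtain ⟨y, h1, h2⟩ := hpriv (e i) (hD' (e i).2)
    exact ⟨y, h1, fun j hj => h2 _ (hD' (e j).2) fun h => hj (e.injective (Subtype.ext h))⟩
  have hiff : ∀ v, v ∈ S ↔ ∀ u ∈ D, ¬ T.StrongAdj v u := by
    intro v
    refine ⟨fun hv u hu => hnadj v hv u (hDS hu), fun h => ?_⟩
    by_contra hv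
    obtain ⟨u, hu, hvu⟩ := hD v hv
    exact h u hu hvu
  have h0 : D.card = 0 ∨ D.card = 1 ∨ D.card = 2 ∨ D.card = 3 := by omega
  rcases h0 with h | h | h | h
  -- An empty `D` means that `S` is everything, so no vertex has a strong neighbour and any triple
  -- works.
  · obtain ⟨a⟩ := ‹Nonempty V›
    rw [Finset.card_eq_zero] at h
    subst h
    have hall : ∀ v, v ∈ S := fun v => (hiff v).2 (by simp)
    exact ⟨(a, a, a), fun v => by simp [hall v, hnadj v (hall v) a (hall a)]⟩
  · obtain ⟨a, rfl⟩ := Finset.card_eq_one.1 h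
    exact ⟨(a, a, a), fun v => by simp [hiff]⟩
  · obtain ⟨a, b, -, rfl⟩ := Finset.card_eq_two.1 h
    exact ⟨(a, b, b), fun v => by simp [hiff]⟩
  · obtain ⟨a, b, c, -, -, -, rfl⟩ := Finset.card_eq_three.1 h
    exact ⟨(a, b, c), fun v => by simp [hiff]⟩

lemma numMaximalIndep_le [Fintype V] [Nonempty V] (hT : ¬ T.HasPrivateQuad) :
    T.numMaximalIndep ≤ Fintype.card V ^ 3 := by
  classical
  let f : V × V × V → Finset V := fun p =>
    {v | ¬ T.StrongAdj v p.1 ∧ ¬ T.StrongAdj v p.2.1 ∧ ¬ T.StrongAdj v p.2.2}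
  have hsub : {S : Finset V | Maximal T.IsIndep S} ⊆ Set.range f := by
    intro S hS
    obtain ⟨p, hp⟩ := exists_triple_of_maximal hT hS
    exact ⟨p, by ext v; simp [f, hp]⟩
  calc T.numMaximalIndep ≤ (Set.range f).ncard := Set.ncard_le_ncard hsub (Set.toFinite _)
    _ ≤ Nat.card (V × V × V) := by
      rw [← Set.image_univ, ← Set.ncard_univ]
      exact Set.ncard_image_le
    _ = Fintype.card V ^ 3 := by
      rw [Nat.card_eq_fintype_card, Fintype.card_prod, Fintype.card_prod]; ring

/-! ### A lower bound for `α` in the class `𝒯₁` -/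

/-- Ramsey-type induction: a vertex with at least `k + 1` neighbours yields them as a strong
independent set. Otherwise deleting it and its neighbours costs at most `k + 1` vertices, exactly
the drop in the binomial coefficient. -/
lemma exists_isStrongIndep_of_triangleFreeOn (k : ℕ) :
    ∀ X : Finset V, T.TriangleFreeOn X → (k + 1).choose 2 ≤ X.card →
      ∃ S ⊆ X, T.IsStrongIndep S ∧ k ≤ S.card := by
  classical
  induction k with
  | zero => exact fun X _ _ => ⟨∅, by simp, by simp [IsStrongIndep], by simp⟩
  | succ k ih =>
    intro X hX hc
    have hch : (k + 1 + 1).choose 2 = (k + 1) + (k + 1).choose 2 := by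
      rw [Nat.choose_succ_succ' (k + 1) 1, Nat.choose_one_right]
    have anti : ∀ {u v}, u ≠ v → ¬ T.Adj u v → T.StrongAnti u v := by
      intro u v h h2
      by_contra h3
      exact h2 ⟨h, fun h4 => h3 ⟨h, h4⟩⟩
    obtain ⟨v, hv⟩ : X.Nonempty := Finset.card_pos.1 (by omega)
    let N : Finset V := {u ∈ X | T.Adj v u}
    by_cases hN : k + 1 ≤ N.card
    · refine ⟨N, Finset.filter_subset _ _, fun a ha b hb hab => ?_, hN⟩
      simp only [N, Finset.mem_filter] at ha hb
      exact anti hab fun h => hX v hv a ha.1 b hb.1 ⟨ha.2, h, hb.2⟩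
    · have hsub : X \ (insert v N) ⊆ X := Finset.sdiff_subset
      have hle := Finset.le_card_sdiff (insert v N) X
      have hins := Finset.card_insert_le v N
      obtain ⟨S, hS, hSi, hSc⟩ := ih (X \ insert v N)
        (fun a ha b hb c hc => hX a (hsub ha) b (hsub hb) c (hsub hc)) (by omega)
      have hvS : v ∉ S := fun h => (Finset.mem_sdiff.1 (hS h)).2 (Finset.mem_insert_self _ _)
      have hva : ∀ u ∈ S, T.StrongAnti v u := by
        intro u hu
        have := Finset.mem_sdiff.1 (hS hu)
        refine anti (fun h => hvS (h ▸ hu)) fun h => this.2 ?_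
        exact Finset.mem_insert_of_mem (Finset.mem_filter.2 ⟨this.1, h⟩)
      refine ⟨insert v S, Finset.insert_subset hv (hS.trans hsub), ?_, ?_⟩
      · intro a ha b hb hab
        rcases Finset.mem_insert.1 ha with rfl | ha' <;>
          rcases Finset.mem_insert.1 hb with rfl | hb'
        · exact absurd rfl hab
        · exact hva b hb'
        · exact (hva a ha').symm
        · exact hSi a ha' b hb' hab
      · rw [Finset.card_insert_of_notMem hvS]; omega

/-- A strong independent set contains no switchable pair, so every vertex contributes its own
weight. -/
lemma card_le_alpha [Fintype V] {w : TrigraphWeight V} (hw : ∀ v, 1 ≤ w.vertex v) {S : Finset V}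
    (hS : T.IsStrongIndep S) : S.card ≤ T.alpha w := by
  classical
  have hind : T.IsIndep S := by
    intro a ha b hb hab
    have := (hS a ha b hb hab).2
    exact ⟨hab, by rw [this]; decide⟩
  have hle : T.weight w S ≤ T.alpha w := by
    unfold alpha
    refine Finset.le_sup (f := T.weight w) ?_
    simpa using hind
  refine le_trans ?_ hle
  unfold weight
  rw [Finset.filter_true_of_mem]
  · calc S.card = ∑ v ∈ S, 1 := by simp
      _ ≤ ∑ v ∈ S, w.vertex v := Finset.sum_le_sum fun v _ => hw v
      _ ≤ _ := Nat.le_add_right _ _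
  · rintro v hv ⟨u, hu, h⟩
    have := (hS v hv u hu h.1).2
    rw [h.2] at this
    exact absurd this (by decide)

/-- In a homogeneous-set-free monogamous trigraph, a clique with nested neighbourhoods and no
switchable pairs leaving it is not much larger than its neighbourhood. -/
lemma card_le_of_nestedNbrs [Fintype V] (hhom : ¬ ∃ S, T.IsHomogeneousSet S)
    (hn : 3 ≤ Fintype.card V) {K : Finset V} (hK : T.IsStrongClique K) (hnest : T.NestedNbrs K)
    (L : Finset V) (hLK : L ⊆ K) (hL : ∀ v ∈ L, ∀ u, ¬ T.Semi v u) :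
    L.card ≤ (T.setNbrs K).ncard + 1 := by
  classical
  obtain ⟨v, A, B, hdis, hAB, -, -, hA, hB⟩ := hnest
  have hcard : (T.setNbrs K).ncard = A.card + B.card := by
    rw [← hAB, ← Finset.coe_union, Set.ncard_coe_finset, Finset.card_union_of_disjoint hdis]
  let a : V → Finset V := fun x => {u ∈ A | T.Adj x u}
  let b : V → Finset V := fun x => {u ∈ B | T.Adj x u}
  have key : ∀ p q, p ≤ q → a (v q) ⊆ a (v p) ∧ b (v p) ⊆ b (v q) := by
    intro p q hpq
    constructor
    · intro u hu
      simp only [a, Finset.mem_filter] at hu ⊢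
      exact hA hpq ⟨hu.1, hu.2⟩
    · intro u hu
      simp only [b, Finset.mem_filter] at hu ⊢
      exact hB hpq ⟨hu.1, hu.2⟩
  have haA : ∀ x, (a x).card ≤ A.card := fun x => Finset.card_filter_le _ _
  have hbB : ∀ x, (b x).card ≤ B.card := fun x => Finset.card_filter_le _ _
  -- `ρ` measures the position in the nested order. It takes values in `0, …, |A| + |B|`, and equal
  -- values force equal neighbourhoods outside `K`.
  let ρ : V → ℕ := fun x => (A.card - (a x).card) + (b x).card
  have hρ : ∀ p q, p ≤ q → ρ (v p) = ρ (v q) → a (v p) = a (v q) ∧ b (v p) = b (v q) := by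
    intro p q hpq h
    obtain ⟨h1, h2⟩ := key p q hpq
    have c1 := Finset.card_le_card h1
    have c2 := Finset.card_le_card h2
    have c3 := haA (v p)
    have c4 := haA (v q)
    simp only [ρ] at h
    exact ⟨(Finset.eq_of_subset_of_card_le h1 (by omega)).symm,
      Finset.eq_of_subset_of_card_le h2 (by omega)⟩
  have hinj : Set.InjOn ρ L := by
    intro x hx y hy hxy
    by_contra hne
    have hxK := hLK hx
    have hyK := hLK hy
    have hab : a x = a y ∧ b x = b y := by
      obtain ⟨p, hp⟩ := v.surjective ⟨x, hxK⟩
      obtain ⟨q, hq⟩ := v.surjective ⟨y, hyK⟩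
      have hp' : (v p : V) = x := by rw [hp]
      have hq' : (v q : V) = y := by rw [hq]
      rw [← hp', ← hq'] at hxy ⊢
      rcases le_total p q with h | h
      · exact hρ p q h hxy
      · exact (hρ q p h hxy.symm).imp Eq.symm Eq.symm
    have hadj : ∀ z, z ∉ K → (T.Adj x z ↔ T.Adj y z) := by
      intro z hz
      have hz1 : ∀ c ∈ K, T.Adj c z → z ∈ A ∨ z ∈ B := by
        intro c hc h
        have : z ∈ T.setNbrs K := ⟨hz, c, hc, h⟩
        rw [← hAB] at this
        exact this
      have h1 : ∀ c c', c ∈ K → a c = a c' → b c = b c' → T.Adj c z → T.Adj c' z := by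
        intro c c' hc e1 e2 h
        rcases hz1 c hc h with hzA | hzB
        · have : z ∈ a c := Finset.mem_filter.2 ⟨hzA, h⟩
          rw [e1] at this
          exact (Finset.mem_filter.1 this).2
        · have : z ∈ b c := Finset.mem_filter.2 ⟨hzB, h⟩
          rw [e2] at this
          exact (Finset.mem_filter.1 this).2
      exact ⟨h1 x y hxK hab.1 hab.2, h1 y x hyK hab.1.symm hab.2.symm⟩
    -- Twins `x`, `y` in no switchable pair form a homogeneous set, a proper one because there are
    -- at least three vertices.
    refine hhom ⟨{x, y}, ?_, ?_, ?_⟩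
    · rw [Finset.card_pair hne]; omega
    · rw [Finset.card_pair hne]; omega
    · intro z hz
      simp only [Finset.mem_insert, Finset.mem_singleton, not_or] at hz
      simp only [Finset.mem_insert, Finset.mem_singleton, forall_eq_or_imp, forall_eq]
      by_cases hzK : z ∈ K
      · exact Or.inl ⟨hK z hzK x hxK hz.1, hK z hzK y hyK hz.2⟩
      · have ex := hadj z hzK
        have tx := strongAdj_or_semi_or_strongAnti (T := T) (Ne.symm hz.1)
        have ty := strongAdj_or_semi_or_strongAnti (T := T) (Ne.symm hz.2)
        have sa : ∀ {c}, T.StrongAdj c z → T.Adj c z := fun h => ⟨h.1, by rw [h.2]; decide⟩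
        have sn : ∀ {c}, T.StrongAnti c z → ¬ T.Adj c z := fun h h' => h'.2 h.2
        rcases tx with h | h | h
        · rcases ty with h' | h' | h'
          · exact Or.inl ⟨h.symm, h'.symm⟩
          · exact absurd h' (hL y hy z)
          · exact absurd (ex.1 (sa h)) (sn h')
        · exact absurd h (hL x hx z)
        · rcases ty with h' | h' | h'
          · exact absurd (ex.2 (sa h')) (sn h)
          · exact absurd h' (hL y hy z)
          · exact Or.inr ⟨h.symm, h'.symm⟩
  rw [hcard, ← Finset.card_range (A.card + B.card + 1)]
  refine Finset.card_le_card_of_injOn ρ (fun x _ => ?_) hinj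
  have := haA x
  have := hbB x
  simp only [ρ, Finset.coe_range, Set.mem_Iio]
  omega

/-- Double counting: neighbours of a clique lie in `X`, since the cliques are strongly anticomplete,
and each vertex of `X` sees at most two cliques. -/
lemma sum_ncard_setNbrs_le [Fintype V] {X : Finset V} {t : ℕ} {K : Fin t → Finset V}
    (hP : T.IsT1Partition X K) : ∑ i, (T.setNbrs (K i)).ncard ≤ 2 * X.card := by
  classical
  let r : Fin t → V → Prop := fun i x => ∃ v ∈ K i, T.Adj x v
  have h1 : ∀ i, (T.setNbrs (K i)).ncard ≤ (X.bipartiteAbove r i).card := by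
    intro i
    rw [← Set.ncard_coe_finset]
    refine Set.ncard_le_ncard ?_ (Set.toFinite _)
    rintro x ⟨hx, v, hv, hvx⟩
    simp only [Finset.mem_coe, Finset.mem_bipartiteAbove]
    refine ⟨?_, v, hv, hvx.symm⟩
    by_contra hX
    obtain ⟨j, hj⟩ := (hP.cover x).resolve_left hX
    have hij : i ≠ j := fun e => hx (e ▸ hj)
    exact hvx.2 (hP.anticomplete i j hij v hv x hj).2
  calc ∑ i, (T.setNbrs (K i)).ncard ≤ ∑ i, (X.bipartiteAbove r i).card :=
        Finset.sum_le_sum fun i _ => h1 i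
    _ = ∑ x ∈ X, (Finset.univ.bipartiteBelow r x).card :=
        Finset.sum_card_bipartiteAbove_eq_sum_card_bipartiteBelow r
    _ ≤ ∑ x ∈ X, 2 := by
        refine Finset.sum_le_sum fun x hx => ?_
        have := hP.atMostTwo x hx
        have hr : ((Finset.univ.bipartiteBelow r x : Finset (Fin t)) : Set (Fin t)) =
            {i | ∃ v ∈ K i, T.Adj x v} := by
          ext i
          simp [Finset.bipartiteBelow, r]
        rwa [← Set.ncard_coe_finset, hr]
    _ = 2 * X.card := by rw [Finset.sum_const, smul_eq_mul, mul_comm]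

-- No switchable pair lies within a clique or between two of them, so partners lie in `X`. Monogamy
-- makes the partner map injective.
open Classical in
lemma sum_card_filter_semi_le (hmono : T.Monogamous) {X : Finset V} {t : ℕ}
    {K : Fin t → Finset V} (hP : T.IsT1Partition X K) :
    ∑ i, ((K i).filter fun v => ∃ u, T.Semi v u).card ≤ X.card := by
  have hf : ∀ v, ∃ u, (∃ u, T.Semi v u) → T.Semi v u := by
    intro v
    by_cases h : ∃ u, T.Semi v u
    · exact h.imp fun u hu _ => hu
    · exact ⟨v, fun h' => absurd h' h⟩
  choose f hf using hf
  rw [← Finset.card_biUnion]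
  · refine Finset.card_le_card_of_injOn f ?_ ?_
    · intro v hv
      simp only [Finset.coe_biUnion, Finset.coe_filter, Set.mem_iUnion, Set.mem_ofPred_eq] at hv
      obtain ⟨i, -, hvi, hs⟩ := hv
      have hs := hf v hs
      by_contra hX
      obtain ⟨j, hj⟩ := (hP.cover (f v)).resolve_left hX
      by_cases hij : i = j
      · subst hij
        have := (hP.strongClique i v hvi _ hj hs.1).2
        rw [hs.2] at this
        exact absurd this (by decide)
      · have := (hP.anticomplete i j hij v hvi _ hj).2
        rw [hs.2] at this
        exact absurd this (by decide)
    · intro v hv v' hv' h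
      simp only [Finset.coe_biUnion, Finset.coe_filter, Set.mem_iUnion, Set.mem_ofPred_eq] at hv hv'
      obtain ⟨-, -, -, hs⟩ := hv
      obtain ⟨-, -, -, hs'⟩ := hv'
      exact hmono (f v) v v' (hf v hs).symm (h ▸ (hf v' hs').symm)
  · intro i _ j _ hij
    exact Finset.disjoint_filter_filter (hP.disjoint i j hij)

/-- One vertex from each nonempty clique gives a strong independent set. -/
lemma card_filter_nonempty_le_alpha [Fintype V] {w : TrigraphWeight V}
    (hw : ∀ v, 1 ≤ w.vertex v) {X : Finset V} {t : ℕ} {K : Fin t → Finset V}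
    (hP : T.IsT1Partition X K) :
    (Finset.univ.filter fun i => (K i).Nonempty).card ≤ T.alpha w := by
  classical
  let I := Finset.univ.filter fun i => (K i).Nonempty
  have hx : ∀ i : I, ∃ v, v ∈ K i := fun i => (Finset.mem_filter.1 i.2).2
  choose x hx using hx
  have hinj : Function.Injective x := by
    intro i j h
    by_contra hne
    exact Finset.disjoint_left.1 (hP.disjoint i j fun e => hne (Subtype.ext e)) (hx i) (h ▸ hx j)
  have : T.IsStrongIndep (Finset.univ.image x) := by
    intro a ha b hb hab
    simp only [Finset.mem_image, Finset.mem_univ, true_and] at ha hb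
    obtain ⟨i, rfl⟩ := ha
    obtain ⟨j, rfl⟩ := hb
    refine hP.anticomplete i j (fun e => hab ?_) _ (hx i) _ (hx j)
    rw [Subtype.ext e]
  have h := card_le_alpha hw this
  rwa [Finset.card_image_of_injective _ hinj, Finset.card_univ, Fintype.card_coe] at h

lemma le_alpha_of_inT1 [Fintype V] {w : TrigraphWeight V} {k : ℕ} (hw : ∀ v, 1 ≤ w.vertex v)
    (hT : T.InT1) (hhom : ¬ ∃ S, T.IsHomogeneousSet S) (hn : 3 ≤ Fintype.card V)
    (hk : 5 * g k < Fintype.card V) : k ≤ T.alpha w := by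
  classical
  by_contra! hlt
  obtain ⟨hmono, X, t, K, hP⟩ := hT
  have hX : X.card < (k + 1).choose 2 := by
    by_contra! h
    obtain ⟨S, -, hS, hSc⟩ := exists_isStrongIndep_of_triangleFreeOn k X hP.triangleFree h
    exact absurd (card_le_alpha hw hS) (by omega)
  -- Both `|X|` and `k - 1`, which bounds the number of nonempty cliques, are at most `g k`. The
  -- final count is `|X| + (k - 1) + 2 |X| + |X|`.
  have hg : X.card + 1 ≤ g k + 1 ∧ k ≤ g k + 1 := by
    obtain ⟨j, rfl⟩ : ∃ j, k = j + 1 := ⟨k - 1, by omega⟩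
    have hch : (j + 1 + 1).choose 2 = (j + 1) + (j + 1).choose 2 := by
      rw [Nat.choose_succ_succ' (j + 1) 1, Nat.choose_one_right]
    unfold g
    omega
  have hI := card_filter_nonempty_le_alpha hw hP
  have hcover : (Finset.univ : Finset V) ⊆ X ∪ Finset.univ.biUnion K := by
    intro v _
    simp only [Finset.mem_union, Finset.mem_biUnion, Finset.mem_univ, true_and]
    exact hP.cover v
  have hKi : ∀ i, (K i).card ≤ (if (K i).Nonempty then 1 else 0) + (T.setNbrs (K i)).ncard +
      ((K i).filter fun v => ∃ u, T.Semi v u).card := by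
    intro i
    split_ifs with hne
    · have h1 := card_le_of_nestedNbrs hhom hn (hP.strongClique i) (hP.nested i)
        ((K i).filter fun v => ¬ ∃ u, T.Semi v u) (Finset.filter_subset _ _)
        fun v hv u h => (Finset.mem_filter.1 hv).2 ⟨u, h⟩
      have h2 := (K i).card_filter_add_card_filter_not fun v => ∃ u, T.Semi v u
      omega
    · rw [Finset.not_nonempty_iff_eq_empty] at hne
      simp [hne]
  have hsum := Finset.sum_le_sum fun i (_ : i ∈ Finset.univ) => hKi i
  rw [Finset.sum_add_distrib, Finset.sum_add_distrib, Finset.sum_boole, Nat.cast_id] at hsum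
  have h1 := sum_ncard_setNbrs_le hP
  have h2 : ∑ i, ((K i).filter fun v => ∃ u, T.Semi v u).card ≤ X.card := by
    convert sum_card_filter_semi_le hmono hP
  have h3 := Finset.card_le_card hcover
  have h4 := Finset.card_union_le X (Finset.univ.biUnion K)
  have h5 : (Finset.univ.biUnion K).card ≤ ∑ i, (K i).card := Finset.card_biUnion_le
  rw [Finset.card_univ] at h3
  omega

/-! ### Bounding the number of vertices by the number of strong edges -/

/-- Otherwise `v` together with its switchable partner, or all vertices but `v` if it has no
partner, would be a homogeneous set. -/
lemma exists_strongAdj_or_semi_strongAdj [Fintype V] (hmono : T.Monogamous)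
    (hhom : ¬ ∃ S, T.IsHomogeneousSet S) (hn : 3 ≤ Fintype.card V) (v : V) :
    (∃ x, T.StrongAdj v x) ∨ ∃ u, T.Semi u v ∧ ∃ x, T.StrongAdj u x := by
  classical
  by_contra! hno
  obtain ⟨hv, hu⟩ := hno
  by_cases hs : ∃ u, T.Semi u v
  · obtain ⟨u, huv⟩ := hs
    have hux := hu u huv
    refine hhom ⟨{u, v}, ?_, ?_, fun z hz => Or.inr ?_⟩
    · rw [Finset.card_pair huv.1]; omega
    · rw [Finset.card_pair huv.1]; omega
    · simp only [Finset.mem_insert, Finset.mem_singleton, not_or] at hz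
      simp only [Finset.mem_insert, Finset.mem_singleton, forall_eq_or_imp, forall_eq]
      constructor
      · rcases strongAdj_or_semi_or_strongAnti (T := T) hz.1 with h | h | h
        · exact absurd h.symm (hux z)
        · exact absurd (hmono u z v h.symm huv) hz.2
        · exact h
      · rcases strongAdj_or_semi_or_strongAnti (T := T) hz.2 with h | h | h
        · exact absurd h.symm (hv z)
        · exact absurd (hmono v z u h.symm huv.symm) hz.1
        · exact h
  · refine hhom ⟨Finset.univ.erase v, ?_, ?_, fun z hz => Or.inr fun x hx => ?_⟩
    · rw [Finset.card_erase_of_mem (Finset.mem_univ v), Finset.card_univ]; omega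
    · rw [Finset.card_erase_of_mem (Finset.mem_univ v), Finset.card_univ]; omega
    · simp only [Finset.mem_erase, Finset.mem_univ, and_true, not_not] at hz hx
      subst hz
      rcases strongAdj_or_semi_or_strongAnti (T := T) hx with h | h | h
      · exact absurd h.symm (hv x)
      · exact absurd ⟨x, h⟩ hs
      · exact h.symm

/-- At most `2 * m` vertices meet a strong edge. The partners of these number no more, by monogamy,
and the two kinds exhaust the vertices. -/
lemma card_le_four_mul_numStrongEdges [Fintype V] (hmono : T.Monogamous)
    (hhom : ¬ ∃ S, T.IsHomogeneousSet S) (hn : 3 ≤ Fintype.card V) :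
    Fintype.card V ≤ 4 * T.numStrongEdges := by
  classical
  let W : Finset V := {v | ∃ x, T.StrongAdj v x}
  let Z : Finset V := {v | ∃ u, T.Semi u v ∧ ∃ x, T.StrongAdj u x}
  have hcover : (Finset.univ : Finset V) ⊆ W ∪ Z := by
    intro v _
    simpa [W, Z] using exists_strongAdj_or_semi_strongAdj hmono hhom hn v
  have hZ : Z.card ≤ W.card := by
    refine Finset.card_le_card_of_forall_subsingleton (fun v u => T.Semi u v) ?_ ?_
    · intro v hv
      obtain ⟨u, h1, h2⟩ := (Finset.mem_filter.1 hv).2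
      exact ⟨u, by simpa [W] using h2, h1⟩
    · rintro u - v ⟨-, hv⟩ v' ⟨-, hv'⟩
      exact hmono u v v' hv hv'
  have hW : W.card ≤ 2 * T.numStrongEdges := by
    have h1 : W ⊆ T.strongGraph.edgeFinset.biUnion Sym2.toFinset := by
      intro v hv
      obtain ⟨x, hx⟩ := (Finset.mem_filter.1 hv).2
      simp only [Finset.mem_biUnion, SimpleGraph.mem_edgeFinset, Sym2.mem_toFinset]
      exact ⟨s(v, x), hx, Sym2.mem_mk_left v x⟩
    have h2 : T.numStrongEdges = T.strongGraph.edgeFinset.card := by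
      rw [numStrongEdges, ← SimpleGraph.coe_edgeFinset, Set.ncard_coe_finset]
    rw [h2, mul_comm]
    refine (Finset.card_le_card h1).trans (Finset.card_biUnion_le_card_mul _ _ _ fun e he => ?_)
    induction e with | _ x y =>
    rw [Sym2.toFinset_mk_eq]
    exact Finset.card_le_two
  have h3 := Finset.card_le_card hcover
  have h4 := Finset.card_union_le W Z
  rw [Finset.card_univ] at h3
  omega

end Combinatorics

end Trigraph

/-! ### Loops on the machine and their running time -/

namespace RAM

/-- `s'` has the same arrays as `s` and the same contents in all registers below `b`. -/
def AgreeBelow (b : ℕ) (s s' : State) : Prop := (∀ r < b, s'.reg r = s.reg r) ∧ s'.arr = s.arr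

lemma AgreeBelow.refl (b : ℕ) (s : State) : AgreeBelow b s s := ⟨fun _ _ => rfl, rfl⟩

lemma AgreeBelow.trans {b : ℕ} {s₁ s₂ s₃ : State} (h : AgreeBelow b s₁ s₂)
    (h' : AgreeBelow b s₂ s₃) : AgreeBelow b s₁ s₃ :=
  ⟨fun r hr => (h'.1 r hr).trans (h.1 r hr), h'.2.trans h.2⟩

lemma AgreeBelow.mono {b c : ℕ} {s s' : State} (hbc : b ≤ c) (h : AgreeBelow c s s') :
    AgreeBelow b s s' :=
  ⟨fun r hr => h.1 r (hr.trans_le hbc), h.2⟩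

lemma agreeBelow_setReg {b r : ℕ} (h : b ≤ r) (s : State) (x : ℕ) :
    AgreeBelow b s (s.setReg r x) :=
  ⟨fun q hq => Function.update_of_ne (by omega) _ _, rfl⟩

/-- The straight-line program that executes a list of instructions. -/
def Prog.block : List Instr → Prog
  | [] => .skip
  | i :: l => .seq (.instr i) (Prog.block l)

lemma exec_block (l : List Instr) (s : State) :
    Exec (.block l) s l.length (l.foldl (fun s i => i.run s) s) := by
  induction l generalizing s with
  | nil => exact .skip s
  | cons i l ih =>
    rw [List.length_cons, add_comm]
    exact .seq (.instr i s) (ih _)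

/-- The instruction writes to a register with number at least `b`. -/
def Instr.WritesFrom (b : ℕ) : Instr → Prop
  | .const r _ | .copy r _ | .add r _ _ | .sub r _ _ | .load r _ _ => b ≤ r
  | .store _ _ _ => False

lemma Instr.WritesFrom.agreeBelow {b : ℕ} {i : Instr} (h : i.WritesFrom b) (s : State) :
    AgreeBelow b s (i.run s) := by
  cases i <;> first | exact agreeBelow_setReg h s _ | exact h.elim

lemma agreeBelow_block {b : ℕ} (l : List Instr) (h : ∀ i ∈ l, i.WritesFrom b) (s : State) :
    AgreeBelow b s (l.foldl (fun s i => i.run s) s) := by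
  induction l generalizing s with
  | nil => exact .refl b s
  | cons i l ih =>
    exact ((h i (by simp)).agreeBelow s).trans (ih (fun j hj => h j (by simp [hj])) _)

/-- Run `body` for the values `0, …, n - 1` of register `a`, where `n` is in register `0`;
register `a + 1` holds `n` times the content of register `a`. Register `2` must hold `1`. -/
def rowLoop (a : ℕ) (body : Prog) : Prog :=
  .seq (.instr (.const a 0)) (.seq (.instr (.const (a + 1) 0))
    (.while (.lt a 0)
      (.seq body (.seq (.instr (.add a a 2)) (.instr (.add (a + 1) (a + 1) 0))))))

/-- The multiple of `n` in register `a + 1` addresses matrix rows without multiplication. Preserving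
registers below `a` lets loops nest with increasing register numbers. Each round adds a test and two
additions to the body; the final `3` is two initialisations and the failing test. -/
lemma exec_rowLoop {n a τ : ℕ} {body : Prog} (I : ℕ → State → Prop) {s₀ : State} (ha : 2 < a)
    (h0 : s₀.reg 0 = n) (h2 : s₀.reg 2 = 1)
    (hI : ∀ j s r x, r = a ∨ r = a + 1 → I j s → I j (s.setReg r x))
    (hbody : ∀ j s, j < n → AgreeBelow a s₀ s → s.reg a = j → s.reg (a + 1) = j * n → I j s →
      ∃ t s', Exec body s t s' ∧ t ≤ τ ∧ AgreeBelow (a + 2) s s' ∧ I (j + 1) s')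
    (hI0 : I 0 s₀) :
    ∃ t s', Exec (rowLoop a body) s₀ t s' ∧ t ≤ n * (τ + 3) + 3 ∧ AgreeBelow a s₀ s' ∧ I n s' := by
  have main : ∀ m j s, j + m = n → AgreeBelow a s₀ s → s.reg a = j → s.reg (a + 1) = j * n →
      I j s → ∃ t s', Exec (.while (.lt a 0)
        (.seq body (.seq (.instr (.add a a 2)) (.instr (.add (a + 1) (a + 1) 0))))) s t s' ∧
        t ≤ m * (τ + 3) + 1 ∧ AgreeBelow a s₀ s' ∧ I n s' := by
    intro m
    induction m with
    | zero =>
      intro j s hj hs hsa hsa1 hIs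
      refine ⟨1, s, .while_false ?_, by omega, hs, ?_⟩
      · show ¬ s.reg a < s.reg 0
        rw [hs.1 0 (by omega), h0, hsa]; omega
      · rwa [← show j = n by omega]
    | succ m ih =>
      intro j s hj hs hsa hsa1 hIs
      obtain ⟨t₁, s₁, he₁, ht₁, hs₁, hI₁⟩ := hbody j s (by omega) hs hsa hsa1 hIs
      let s₂ := s₁.setReg a (s₁.reg a + s₁.reg 2)
      let s₃ := s₂.setReg (a + 1) (s₂.reg (a + 1) + s₂.reg 0)
      have hs' : AgreeBelow a s₀ s₁ := hs.trans (hs₁.mono (by omega))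
      have hs₃ : AgreeBelow a s₀ s₃ := hs'.trans
        ((agreeBelow_setReg le_rfl _ _).trans (agreeBelow_setReg (by omega) _ _))
      have e2 : s₁.reg 2 = 1 := by rw [hs'.1 2 ha, h2]
      have e0 : s₁.reg 0 = n := by rw [hs'.1 0 (by omega), h0]
      have ea : s₃.reg a = j + 1 := by
        simp [s₃, s₂, State.setReg, Function.update_apply, hs₁.1 a (by omega), hsa, e2]
      have ea1 : s₃.reg (a + 1) = (j + 1) * n := by
        have : (0 : ℕ) ≠ a := by omega
        simp [s₃, s₂, State.setReg, hs₁.1 (a + 1) (by omega), hsa1, e0, this,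
          add_mul]
      obtain ⟨t₂, s', he₂, ht₂, hs₂, hI₂⟩ := ih (j + 1) s₃ (by omega) hs₃ ea ea1
        (hI _ _ _ _ (Or.inr rfl) (hI _ _ _ _ (Or.inl rfl) hI₁))
      refine ⟨(t₁ + (1 + 1)) + t₂ + 1, s', .while_true ?_ (.seq he₁ (.seq (.instr _ _)
        (.instr _ _))) he₂, ?_, hs₂, hI₂⟩
      · show s.reg a < s.reg 0
        rw [hs.1 0 (by omega), h0, hsa]; omega
      · rw [add_mul]; omega
  let s₁ := s₀.setReg a 0
  let s₂ := s₁.setReg (a + 1) 0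
  obtain ⟨t, s', he, ht, hs, hIn⟩ := main n 0 s₂ (by omega)
    ((agreeBelow_setReg le_rfl _ _).trans (agreeBelow_setReg (by omega) _ _))
    (by simp [s₂, s₁, State.setReg])
    (by simp [s₂, State.setReg])
    (hI _ _ _ _ (Or.inr rfl) (hI _ _ _ _ (Or.inl rfl) hI0))
  exact ⟨1 + (1 + t), s', .seq (.instr _ _) (.seq (.instr _ _) he), by omega, hs, hIn⟩

lemma exec_rowLoop_sum {n a c τ : ℕ} {body : Prog} (F : ℕ → ℕ) {s₀ : State} (ha : 2 < a)
    (hc : a + 1 < c) (h0 : s₀.reg 0 = n) (h2 : s₀.reg 2 = 1)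
    (hbody : ∀ j s, j < n → AgreeBelow a s₀ s → s.reg a = j → s.reg (a + 1) = j * n →
      ∃ t s', Exec body s t s' ∧ t ≤ τ ∧ AgreeBelow (a + 2) s s' ∧ s'.reg c = s.reg c + F j) :
    ∃ t s', Exec (rowLoop a body) s₀ t s' ∧ t ≤ n * (τ + 3) + 3 ∧ AgreeBelow a s₀ s' ∧
      s'.reg c = s₀.reg c + ∑ j ∈ Finset.range n, F j := by
  refine exec_rowLoop (fun m s => s.reg c = s₀.reg c + ∑ j ∈ Finset.range m, F j) ha h0 h2
    ?_ ?_ (by simp)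
  · intro j s r x hr h
    have : c ≠ r := by omega
    simpa [State.setReg, Function.update_apply, this] using h
  · intro j s hj hs hsa hsa1 hIs
    obtain ⟨t, s', he, ht, hs', hc'⟩ := hbody j s hj hs hsa hsa1
    exact ⟨t, s', he, ht, hs', by rw [hc', hIs, Finset.sum_range_succ, add_assoc]⟩

/-! ### The search for a private quadruple -/

/-- For a matrix with entries `0`, `1`, `2` stored row by row: whether the entry is `2`. -/
def entry (A : ℕ → ℕ) (n u v : ℕ) : ℕ := A (u * n + v) - 1

/-- Whether row `y` has an entry `2` in column `a` only, among the columns `a, b, c, d`. -/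
def onlyFirst (A : ℕ → ℕ) (n a b c d y : ℕ) : ℕ :=
  entry A n y a - entry A n y b - entry A n y c - entry A n y d

/-- Whether `a, b, c, d` have no entry `2` among themselves and each of them is the only one
with an entry `2` in some row. -/
def quad (A : ℕ → ℕ) (n a b c d : ℕ) : ℕ :=
  1 - ((1 - ∑ y ∈ Finset.range n, onlyFirst A n a b c d y) +
    (1 - ∑ y ∈ Finset.range n, onlyFirst A n b a c d y) +
    (1 - ∑ y ∈ Finset.range n, onlyFirst A n c a b d y) +
    (1 - ∑ y ∈ Finset.range n, onlyFirst A n d a b c y) +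
    (entry A n a b + entry A n a c + entry A n a d + entry A n b c + entry A n b d +
      entry A n c d))

/-- Add to the registers `14, …, 17` whether the vertex in register `12` is a private neighbour of
the vertex in register `4`, `6`, `8`, `10`, respectively. -/
def privateBlock : List Instr :=
  [.add 18 13 4, .load 18 0 18, .sub 18 18 2,
   .add 19 13 6, .load 19 0 19, .sub 19 19 2,
   .add 20 13 8, .load 20 0 20, .sub 20 20 2,
   .add 21 13 10, .load 21 0 21, .sub 21 21 2,
   .sub 22 18 19, .sub 22 22 20, .sub 22 22 21, .add 14 14 22,
   .sub 22 19 18, .sub 22 22 20, .sub 22 22 21, .add 15 15 22,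
   .sub 22 20 18, .sub 22 22 19, .sub 22 22 21, .add 16 16 22,
   .sub 22 21 18, .sub 22 22 19, .sub 22 22 20, .add 17 17 22]

/-- Add `1` to register `30` if the registers `14, …, 17` are positive and there are no strong edges
between the vertices in the registers `4`, `6`, `8`, `10`. -/
def countBlock : List Instr :=
  [.add 18 5 6, .load 18 0 18, .sub 18 18 2,
   .add 19 5 8, .load 19 0 19, .sub 19 19 2,
   .add 20 5 10, .load 20 0 20, .sub 20 20 2,
   .add 21 7 8, .load 21 0 21, .sub 21 21 2,
   .add 22 7 10, .load 22 0 22, .sub 22 22 2,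
   .add 23 9 10, .load 23 0 23, .sub 23 23 2,
   .add 18 18 19, .add 18 18 20, .add 18 18 21, .add 18 18 22, .add 18 18 23,
   .sub 24 2 14, .sub 25 2 15, .add 24 24 25, .sub 25 2 16, .add 24 24 25, .sub 25 2 17,
   .add 24 24 25, .add 24 24 18, .sub 24 2 24, .add 30 30 24]

/-- Add to register `30` the number `quad` for the vertices in the registers `4`, `6`, `8`, `10`. -/
def quadProg : Prog :=
  .seq (.block [.const 14 0, .const 15 0, .const 16 0, .const 17 0])
    (.seq (rowLoop 12 (.block privateBlock)) (.block countBlock))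

/-- `31` is the 28 instructions of `privateBlock` plus the loop overhead; `40` is 4 initialisations,
3 for the loop and 33 for `countBlock`. -/
lemma exec_quadProg {n a b c d : ℕ} {s : State} (h0 : s.reg 0 = n) (h2 : s.reg 2 = 1)
    (ha : s.reg 4 = a) (ha' : s.reg 5 = a * n) (hb : s.reg 6 = b) (hb' : s.reg 7 = b * n)
    (hc : s.reg 8 = c) (hc' : s.reg 9 = c * n) (hd : s.reg 10 = d) :
    ∃ t s', Exec quadProg s t s' ∧ t ≤ n * 31 + 40 ∧ AgreeBelow 12 s s' ∧
      s'.reg 30 = s.reg 30 + quad (s.arr 0) n a b c d := by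
  let A := s.arr 0
  let l : List Instr := [.const 14 0, .const 15 0, .const 16 0, .const 17 0]
  set s₁ := l.foldl (fun s i => i.run s) s with hs₁
  have hA₁ : AgreeBelow 14 s s₁ := agreeBelow_block l (by simp [l, Instr.WritesFrom]) s
  have h30 : s₁.reg 30 = s.reg 30 := by simp [hs₁, l, Instr.run, State.setReg]
  let I : ℕ → State → Prop := fun m s' =>
    s'.reg 14 = ∑ y ∈ Finset.range m, onlyFirst A n a b c d y ∧
    s'.reg 15 = ∑ y ∈ Finset.range m, onlyFirst A n b a c d y ∧
    s'.reg 16 = ∑ y ∈ Finset.range m, onlyFirst A n c a b d y ∧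
    s'.reg 17 = ∑ y ∈ Finset.range m, onlyFirst A n d a b c y ∧
    s'.reg 30 = s.reg 30
  obtain ⟨t, s₂, he, ht, hA₂, e14, e15, e16, e17, e30⟩ :=
    exec_rowLoop (n := n) (a := 12) (τ := 28) (body := .block privateBlock) I (s₀ := s₁)
      (by norm_num) ((hA₁.1 0 (by norm_num)).trans h0) ((hA₁.1 2 (by norm_num)).trans h2)
      (by
        rintro j s' r x (rfl | rfl) h <;> simpa [I, State.setReg] using h)
      (by
        intro j s' hj hs' hy hy' ⟨e14, e15, e16, e17, e30⟩
        have hA' : AgreeBelow 12 s s' := (hA₁.mono (by norm_num)).trans hs'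
        refine ⟨_, _, exec_block _ _, le_rfl, agreeBelow_block _ (by
          simp [privateBlock, Instr.WritesFrom]) _, ?_⟩
        have g2 := (hA'.1 2 (by norm_num)).trans h2
        have g4 := (hA'.1 4 (by norm_num)).trans ha
        have g6 := (hA'.1 6 (by norm_num)).trans hb
        have g8 := (hA'.1 8 (by norm_num)).trans hc
        have g10 := (hA'.1 10 (by norm_num)).trans hd
        have gA : s'.arr 0 = A := by rw [hA'.2]
        have g13 : s'.reg 13 = j * n := hy'
        simp only [I, Finset.sum_range_succ]
        simp [privateBlock, Instr.run, State.setReg, onlyFirst, entry,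
          g2, g4, g6, g8, g10, gA, g13, e14, e15, e16, e17, e30])
      (by simp [I, hs₁, l, Instr.run, State.setReg])
  have hA' : AgreeBelow 12 s s₂ := (hA₁.mono (by norm_num)).trans hA₂
  refine ⟨_, _, .seq (exec_block _ _) (.seq he (exec_block _ _)), ?_,
    hA'.trans (agreeBelow_block _ (by simp [countBlock, Instr.WritesFrom]) _), ?_⟩
  · simp only [countBlock, List.length_cons, List.length_nil]
    omega
  · have g2 := (hA'.1 2 (by norm_num)).trans h2
    have g5 := (hA'.1 5 (by norm_num)).trans ha'
    have g6 := (hA'.1 6 (by norm_num)).trans hb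
    have g7 := (hA'.1 7 (by norm_num)).trans hb'
    have g8 := (hA'.1 8 (by norm_num)).trans hc
    have g9 := (hA'.1 9 (by norm_num)).trans hc'
    have g10 := (hA'.1 10 (by norm_num)).trans hd
    have gA : s₂.arr 0 = A := by rw [hA'.2]
    simp [countBlock, Instr.run, State.setReg, quad, entry,
      g2, g5, g6, g7, g8, g9, g10, gA, e14, e15, e16, e17, e30, A]

/-- Add to register `30` the sum of `quad` over all quadruples of vertices. -/
def quadLoops : Prog := rowLoop 4 (rowLoop 6 (rowLoop 8 (rowLoop 10 quadProg)))

lemma exec_quadLoops {n : ℕ} {s : State} (h0 : s.reg 0 = n) (h2 : s.reg 2 = 1) :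
    ∃ t s', Exec quadLoops s t s' ∧
      t ≤ n * (n * (n * (n * (n * 31 + 40 + 3) + 3 + 3) + 3 + 3) + 3 + 3) + 3 ∧
      AgreeBelow 4 s s' ∧
      s'.reg 30 = s.reg 30 + ∑ a ∈ Finset.range n, ∑ b ∈ Finset.range n, ∑ c ∈ Finset.range n,
        ∑ d ∈ Finset.range n, quad (s.arr 0) n a b c d := by
  refine exec_rowLoop_sum _ (by norm_num) (by norm_num) h0 h2 fun a s₁ _ hs₁ ha ha' => ?_
  rw [← hs₁.2]
  have h0 := (hs₁.1 0 (by norm_num)).trans h0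
  have h2 := (hs₁.1 2 (by norm_num)).trans h2
  refine exec_rowLoop_sum _ (by norm_num) (by norm_num) h0 h2 fun b s₂ _ hs₂ hb hb' => ?_
  rw [← hs₂.2]
  have h0 := (hs₂.1 0 (by norm_num)).trans h0
  have h2 := (hs₂.1 2 (by norm_num)).trans h2
  have ha := (hs₂.1 4 (by norm_num)).trans ha
  have ha' := (hs₂.1 5 (by norm_num)).trans ha'
  refine exec_rowLoop_sum _ (by norm_num) (by norm_num) h0 h2 fun c s₃ _ hs₃ hc hc' => ?_
  rw [← hs₃.2]
  have h0 := (hs₃.1 0 (by norm_num)).trans h0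
  have h2 := (hs₃.1 2 (by norm_num)).trans h2
  have ha := (hs₃.1 4 (by norm_num)).trans ha
  have ha' := (hs₃.1 5 (by norm_num)).trans ha'
  have hb := (hs₃.1 6 (by norm_num)).trans hb
  have hb' := (hs₃.1 7 (by norm_num)).trans hb'
  refine exec_rowLoop_sum _ (by norm_num) (by norm_num) h0 h2 fun d s₄ _ hs₄ hd hd' => ?_
  rw [← hs₄.2]
  exact exec_quadProg ((hs₄.1 0 (by norm_num)).trans h0) ((hs₄.1 2 (by norm_num)).trans h2)
    ((hs₄.1 4 (by norm_num)).trans ha) ((hs₄.1 5 (by norm_num)).trans ha')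
    ((hs₄.1 6 (by norm_num)).trans hb) ((hs₄.1 7 (by norm_num)).trans hb')
    ((hs₄.1 8 (by norm_num)).trans hc) ((hs₄.1 9 (by norm_num)).trans hc') hd

/-! ### The complete program -/

/-- The algorithm: output `1` if `n ≤ 5 * g k`, otherwise `3` if `k = 1` or some quadruple of
vertices has positive `quad`, and `2` otherwise. -/
def decisionProg : Prog :=
  .seq (.block [.const 2 1])
  (.seq (rowLoop 4 (.block [.sub 32 1 4, .add 31 31 32]))
  (.seq (.block [.sub 31 31 2, .add 32 31 31, .add 32 32 32, .add 3 32 31,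
    .add 32 2 2, .sub 30 32 1])
  (.seq quadLoops
  (.seq (.block [.const 31 0])
  (.ite (.lt 3 0) (.ite (.lt 31 30) (.instr (.const 0 3)) (.instr (.const 0 2)))
    (.instr (.const 0 1)))))))

lemma exec_decisionProg {n k : ℕ} {s : State} (h0 : s.reg 0 = n) (h1 : s.reg 1 = k)
    (h31 : s.reg 31 = 0) :
    ∃ t s', Exec decisionProg s t s' ∧ t ≤ 300 * (n ^ 5 + 1) ∧
      s'.reg 0 = if 5 * (∑ j ∈ Finset.range n, (k - j) - 1) < n then
        (if 0 < (2 - k) + ∑ a ∈ Finset.range n, ∑ b ∈ Finset.range n, ∑ c ∈ Finset.range n,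
          ∑ d ∈ Finset.range n, quad (s.arr 0) n a b c d then 3 else 2) else 1 := by
  let s₁ := s.setReg 2 1
  obtain ⟨t₁, s₂, he₁, ht₁, hs₂, h31'⟩ :=
    exec_rowLoop_sum (n := n) (a := 4) (c := 31) (τ := 2) (fun j => k - j)
      (body := .block [.sub 32 1 4, .add 31 31 32]) (s₀ := s₁) (by norm_num) (by norm_num)
      (by simpa [s₁, State.setReg] using h0) (by simp [s₁, State.setReg])
      (by
        intro j s' _ hs' hj _
        refine ⟨_, _, exec_block _ _, le_rfl, agreeBelow_block _ (by simp [Instr.WritesFrom]) _, ?_⟩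
        have g1 : s'.reg 1 = k := by
          rw [hs'.1 1 (by norm_num)]
          simpa [s₁, State.setReg] using h1
        simp [Instr.run, State.setReg, g1, hj])
  have g0 : s₂.reg 0 = n := by
    rw [hs₂.1 0 (by norm_num)]; simpa [s₁, State.setReg] using h0
  have g1 : s₂.reg 1 = k := by
    rw [hs₂.1 1 (by norm_num)]; simpa [s₁, State.setReg] using h1
  have g2 : s₂.reg 2 = 1 := by
    rw [hs₂.1 2 (by norm_num)]; simp [s₁, State.setReg]
  have g31 : s₂.reg 31 = ∑ j ∈ Finset.range n, (k - j) := by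
    rw [h31']; simp [s₁, State.setReg, h31]
  -- Multiplication by five is two doublings and an addition. For positive `k`, the initial value `2
  -- - k` of register 30 is nonzero only when `k = 1`.
  let l : List Instr := [.sub 31 31 2, .add 32 31 31, .add 32 32 32, .add 3 32 31,
    .add 32 2 2, .sub 30 32 1]
  set s₃ := l.foldl (fun s i => i.run s) s₂ with hs₃
  have f0 : s₃.reg 0 = n := by simp [hs₃, l, Instr.run, State.setReg, g0]
  have f2 : s₃.reg 2 = 1 := by simp [hs₃, l, Instr.run, State.setReg, g2]
  have f3 : s₃.reg 3 = 5 * (∑ j ∈ Finset.range n, (k - j) - 1) := by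
    simp [hs₃, l, Instr.run, State.setReg, g2, g31]; ring
  have f30 : s₃.reg 30 = 2 - k := by
    simp [hs₃, l, Instr.run, State.setReg, g1, g2]
  have fA : s₃.arr = s.arr := by
    simp [hs₃, l, Instr.run, State.setReg, hs₂.2, s₁]
  obtain ⟨t₂, s₄, he₂, ht₂, hs₄, h30⟩ := exec_quadLoops f0 f2
  rw [f30, fA] at h30
  set S := (2 - k) + ∑ a ∈ Finset.range n, ∑ b ∈ Finset.range n, ∑ c ∈ Finset.range n,
    ∑ d ∈ Finset.range n, quad (s.arr 0) n a b c d with hS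
  set G := 5 * (∑ j ∈ Finset.range n, (k - j) - 1) with hG
  let s₅ := s₄.setReg 31 0
  have k0 : s₅.reg 0 = n := by simp [s₅, State.setReg, hs₄.1 0 (by norm_num), f0]
  have k3 : s₅.reg 3 = G := by simp [s₅, State.setReg, hs₄.1 3 (by norm_num), f3]
  have k30 : s₅.reg 30 = S := by simp [s₅, State.setReg, h30]
  have k31 : s₅.reg 31 = 0 := by simp [s₅, State.setReg]
  have hfin : ∃ t s', Exec (.ite (.lt 3 0) (.ite (.lt 31 30) (.instr (.const 0 3))
      (.instr (.const 0 2))) (.instr (.const 0 1))) s₅ t s' ∧ t ≤ 3 ∧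
      s'.reg 0 = if G < n then (if 0 < S then 3 else 2) else 1 := by
    by_cases hc : G < n
    · have hc' : (Test.lt 3 0).Holds s₅ := by
        show s₅.reg 3 < s₅.reg 0
        rwa [k0, k3]
      by_cases hd : 0 < S
      · refine ⟨_, _, .ite_true hc' (.ite_true ?_ (.instr _ _)), le_rfl, ?_⟩
        · show s₅.reg 31 < s₅.reg 30
          rwa [k31, k30]
        · simp [Instr.run, State.setReg, hc, hd]
      · refine ⟨_, _, .ite_true hc' (.ite_false ?_ (.instr _ _)), le_rfl, ?_⟩
        · show ¬ s₅.reg 31 < s₅.reg 30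
          rwa [k31, k30]
        · rw [if_pos hc, if_neg hd]
          simp [Instr.run, State.setReg]
    · refine ⟨_, _, .ite_false ?_ (.instr _ _), by norm_num, ?_⟩
      · show ¬ s₅.reg 3 < s₅.reg 0
        rwa [k0, k3]
      · simp [Instr.run, State.setReg, hc]
  obtain ⟨t₃, s₆, he₃, ht₃, hout⟩ := hfin
  refine ⟨_, s₆, .seq (exec_block _ _) (.seq he₁ (.seq (exec_block _ _) (.seq he₂
    (.seq (exec_block _ _) he₃)))), ?_, hout⟩
  simp only [List.length_cons, List.length_nil]
  have hp : ∀ i, i ≤ 5 → n ^ i ≤ n ^ 5 + 1 := by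
    intro i hi
    rcases Nat.eq_zero_or_pos n with rfl | hn
    · rcases Nat.eq_zero_or_pos i with rfl | hi'
      · simp
      · simp [Nat.pos_iff_ne_zero.1 hi']
    · exact (Nat.pow_le_pow_right hn hi).trans (Nat.le_succ _)
  have p1 := hp 1 (by norm_num)
  have p2 := hp 2 (by norm_num)
  have p3 := hp 3 (by norm_num)
  have p4 := hp 4 (by norm_num)
  have e : n * (n * (n * (n * (n * 31 + 40 + 3) + 3 + 3) + 3 + 3) + 3 + 3) + 3 =
      31 * n ^ 5 + 43 * n ^ 4 + 6 * n ^ 3 + 6 * n ^ 2 + 6 * n ^ 1 + 3 := by ring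
  rw [e] at ht₂
  rw [← pow_one n] at ht₁
  omega

end RAM

/-! ### Meaning of the computed numbers -/

namespace Trigraph

open RAM

open Classical in
lemma entry_inputState {n : ℕ} (T : Trigraph (Fin n)) (w : TrigraphWeight (Fin n)) (k : ℕ)
    (u v : Fin n) :
    entry ((T.inputState w k).arr 0) n u v = if T.StrongAdj u v then 1 else 0 := by
  have hlt : (u : ℕ) * n + v < n * n := by
    calc (u : ℕ) * n + v < u * n + n := by omega
      _ = (u + 1) * n := by ring
      _ ≤ n * n := Nat.mul_le_mul_right n u.2
  have hn : 0 < n := u.pos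
  have hdiv : Fin.divNat (⟨u * n + v, hlt⟩ : Fin (n * n)) = u := by
    apply Fin.ext
    simp [Fin.divNat, mul_comm (u : ℕ) n, Nat.mul_add_div hn]
  have hmod : Fin.modNat (⟨u * n + v, hlt⟩ : Fin (n * n)) = v := by
    apply Fin.ext
    simp [Fin.modNat, mul_comm (u : ℕ) n, Nat.mod_eq_of_lt v.2]
  -- Subtracting 1 identifies switchable pairs, and the diagonal, with strong antiedges.
  have hcode : ∀ a : SignType, code a - 1 = if a = 1 then 1 else 0 := by decide
  have hadj : T.StrongAdj u v ↔ T.θ u v = 1 := by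
    refine ⟨fun h => h.2, fun h => ⟨?_, h⟩⟩
    rintro rfl
    rw [T.diag] at h
    exact absurd h (by decide)
  simp only [entry, inputState, if_true, dif_pos hlt, hdiv, hmod, hcode, hadj]

lemma onlyFirst_pos_iff {n : ℕ} (T : Trigraph (Fin n)) (w : TrigraphWeight (Fin n)) (k : ℕ)
    (a b c d y : Fin n) :
    0 < onlyFirst ((T.inputState w k).arr 0) n a b c d y ↔
      T.StrongAdj y a ∧ ¬ T.StrongAdj y b ∧ ¬ T.StrongAdj y c ∧ ¬ T.StrongAdj y d := by
  simp only [onlyFirst, entry_inputState]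
  split_ifs <;> simp [*]

lemma sum_range_pos_iff {n : ℕ} (f : ℕ → ℕ) :
    0 < ∑ j ∈ Finset.range n, f j ↔ ∃ j : Fin n, 0 < f j := by
  rw [← Fin.sum_univ_eq_sum_range, Finset.sum_pos_iff]
  simp

lemma quad_pos_iff {n : ℕ} (T : Trigraph (Fin n)) (w : TrigraphWeight (Fin n)) (k : ℕ)
    (a b c d : Fin n) :
    0 < quad ((T.inputState w k).arr 0) n a b c d ↔
      (∀ i j, ¬ T.StrongAdj (![a, b, c, d] i) (![a, b, c, d] j)) ∧
        ∀ i, ∃ y, T.StrongAdj y (![a, b, c, d] i) ∧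
          ∀ j, j ≠ i → ¬ T.StrongAdj y (![a, b, c, d] j) := by
  have hirr : ∀ v, ¬ T.StrongAdj v v := fun v h => h.1 rfl
  have hcomm : ∀ u v, T.StrongAdj u v ↔ T.StrongAdj v u := fun u v => ⟨.symm, .symm⟩
  have h01 : ∀ u v : Fin n, entry ((T.inputState w k).arr 0) n u v = 0 ↔ ¬ T.StrongAdj u v := by
    intro u v
    simp [entry_inputState]
  -- In truncated arithmetic `1 - x` expresses `x = 0`, and positivity of a sum expresses a
  -- disjunction.
  have hquad : ∀ A, 0 < quad A n a b c d ↔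
      (0 < ∑ y ∈ Finset.range n, onlyFirst A n a b c d y ∧
      0 < ∑ y ∈ Finset.range n, onlyFirst A n b a c d y ∧
      0 < ∑ y ∈ Finset.range n, onlyFirst A n c a b d y ∧
      0 < ∑ y ∈ Finset.range n, onlyFirst A n d a b c y) ∧
      entry A n a b = 0 ∧ entry A n a c = 0 ∧ entry A n a d = 0 ∧ entry A n b c = 0 ∧
      entry A n b d = 0 ∧ entry A n c d = 0 := by
    intro A
    unfold quad
    omega
  rw [hquad]
  simp only [sum_range_pos_iff, onlyFirst_pos_iff, h01]
  simp only [Fin.forall_fin_succ]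
  simp [hirr, hcomm b a, hcomm c a, hcomm d a, hcomm c b, hcomm d b, hcomm d c]
  constructor
  · rintro ⟨h, h1, h2, h3, h4, h5, h6⟩
    exact ⟨⟨⟨h1, h2, h3⟩, ⟨h1, h4, h5⟩, ⟨h2, h4, h6⟩, h3, h5, h6⟩, h⟩
  · rintro ⟨⟨⟨h1, h2, h3⟩, ⟨-, h4, h5⟩, ⟨-, -, h6⟩, -⟩, h⟩
    exact ⟨h, h1, h2, h3, h4, h5, h6⟩

lemma sum_quad_pos_iff {n : ℕ} (T : Trigraph (Fin n)) (w : TrigraphWeight (Fin n)) (k : ℕ) :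
    0 < ∑ a ∈ Finset.range n, ∑ b ∈ Finset.range n, ∑ c ∈ Finset.range n,
      ∑ d ∈ Finset.range n, quad ((T.inputState w k).arr 0) n a b c d ↔ T.HasPrivateQuad := by
  simp only [sum_range_pos_iff, quad_pos_iff]
  constructor
  · rintro ⟨a, b, c, d, h⟩
    exact ⟨_, h⟩
  · rintro ⟨d, h⟩
    refine ⟨d 0, d 1, d 2, d 3, ?_⟩
    have : ![d 0, d 1, d 2, d 3] = d := by
      ext i
      fin_cases i <;> rfl
    rwa [this]

lemma g_succ (j : ℕ) : g (j + 1) = j + (j + 1).choose 2 := by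
  have h : (j + 1 + 1).choose 2 = (j + 1) + (j + 1).choose 2 := by
    rw [Nat.choose_succ_succ' (j + 1) 1, Nat.choose_one_right]
  unfold g
  omega

lemma sum_range_sub_eq {n k : ℕ} (h : k ≤ n) :
    ∑ j ∈ Finset.range n, (k - j) = (k + 1).choose 2 := by
  rw [← Finset.sum_subset (Finset.range_mono h)
    (fun j _ hj => by simp only [Finset.mem_range, not_lt] at hj; omega)]
  clear h
  induction k with
  | zero => simp
  | succ k ih =>
    rw [Finset.sum_range_succ', Nat.choose_succ_succ' (k + 1) 1, Nat.choose_one_right, ← ih]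
    simp [add_comm]

/-- Only the first `n` terms of the sum `k + (k - 1) + …` matter for comparing `5 * g k` to `n`. -/
lemma five_mul_sum_lt_iff {n k : ℕ} (hk : 0 < k) :
    5 * (∑ j ∈ Finset.range n, (k - j) - 1) < n ↔ 5 * g k < n := by
  rcases le_or_gt k n with h | h
  · rw [sum_range_sub_eq h, g]
  -- Here `k > n`. For positive `n` the term `k` alone makes the left quantity at least `5 * (k - 1)
  -- ≥ n`, and `g k ≥ k - 1`, so both comparisons fail. Hence no loop of length `k` is needed.
  · rcases Nat.eq_zero_or_pos n with rfl | hn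
    · simp
    · have h1 : k - 0 ≤ ∑ j ∈ Finset.range n, (k - j) :=
        Finset.single_le_sum (f := fun j => k - j) (fun _ _ => Nat.zero_le _)
          (Finset.mem_range.2 hn)
      obtain ⟨j, rfl⟩ : ∃ j, k = j + 1 := ⟨k - 1, by omega⟩
      rw [g_succ]
      omega

lemma one_le_alpha {V : Type*} [Fintype V] [Nonempty V] (T : Trigraph V) {w : TrigraphWeight V}
    (hw : ∀ v, 1 ≤ w.vertex v) : 1 ≤ T.alpha w := by
  classical
  obtain ⟨v⟩ := ‹Nonempty V›
  have h : T.IsStrongIndep {v} := by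
    intro a ha b hb hab
    rw [Finset.mem_singleton] at ha hb
    exact absurd (ha.trans hb.symm) hab
  simpa using card_le_alpha hw h

end Trigraph

/-! ### The main theorem -/

theorem lemma3 :
    ∃ (P : RAM.Prog) (C : ℕ),
      ∀ (n : ℕ) (T : Trigraph (Fin n)) (w : TrigraphWeight (Fin n)) (k : ℕ),
        T.Monogamous → T.IsBasic →
        (∀ v, 1 ≤ w.vertex v) →
        (∀ u v, T.Semi u v → 2 ≤ w.pair s(u, v)) →
        (¬ ∃ S, T.IsHomogeneousSet S) →
        0 < k →
        ∃ (t : ℕ) (s : RAM.State),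
          RAM.Exec P (T.inputState w k) t s ∧
          t ≤ C * (n ^ 4 * T.numStrongEdges + 1) ∧
          T.OutputTrue w k (s.reg 0) := by
  -- `33 = 2 ^ 5 + 1` covers `n ≤ 2`, where `n ≤ 4 * m` is not available; for larger `n` a factor 4
  -- would do.
  refine ⟨RAM.decisionProg, 300 * 33, fun n T w k hmono hbasic hw _ hhom hk => ?_⟩
  obtain ⟨t, s, he, ht, hs⟩ := RAM.exec_decisionProg (n := n) (k := k) (s := T.inputState w k)
    (by simp [Trigraph.inputState]) (by simp [Trigraph.inputState])
    (by simp [Trigraph.inputState])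
  refine ⟨t, s, he, ht.trans ?_, ?_⟩
  · rw [mul_assoc]
    refine Nat.mul_le_mul_left _ ?_
    rcases Nat.lt_or_ge n 3 with hn | hn
    · have : n ^ 5 ≤ 2 ^ 5 := Nat.pow_le_pow_left (by omega) 5
      omega
    · have h := Trigraph.card_le_four_mul_numStrongEdges hmono hhom (by simpa using hn)
      rw [Fintype.card_fin] at h
      have h5 : n ^ 5 ≤ n ^ 4 * (4 * T.numStrongEdges) := by
        rw [pow_succ]
        exact Nat.mul_le_mul_left _ h
      rw [mul_left_comm] at h5
      omega
  · simp only [Trigraph.five_mul_sum_lt_iff hk] at hs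
    rw [hs]
    by_cases hg : 5 * Trigraph.g k < n
    · rw [if_pos hg]
      have : Nonempty (Fin n) := ⟨⟨0, by omega⟩⟩
      have hpos := Trigraph.sum_quad_pos_iff T w k
      split_ifs with h
      · refine Or.inr (Or.inr ⟨rfl, ?_⟩)
        -- Since `g 1 = 0`, the case `k = 1` does not exclude `𝒯₀`; there a single vertex suffices.
        -- For `k ≥ 2`, `n > 10` excludes it.
        obtain rfl | hk2 : k = 1 ∨ 2 ≤ k := by omega
        · exact T.one_le_alpha hw
        have hg2 : 2 ≤ Trigraph.g k := by
          have := Nat.choose_le_choose 2 (show 3 ≤ k + 1 by omega)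
          have h3 : Nat.choose 3 2 = 3 := rfl
          unfold Trigraph.g
          omega
        have hquad := hpos.1 (by omega)
        rcases hbasic with h0 | h1 | h1
        · have := h0.2
          rw [Fintype.card_fin] at this
          omega
        · exact Trigraph.le_alpha_of_inT1 hw h1 hhom (by rw [Fintype.card_fin]; omega)
            (by rwa [Fintype.card_fin])
        · exact absurd hquad (Trigraph.not_hasPrivateQuad_of_compl h1)
      · refine Or.inr (Or.inl ⟨rfl, ?_⟩)
        have := Trigraph.numMaximalIndep_le (T := T) fun hq => h (by have := hpos.2 hq; omega)
        rwa [Fintype.card_fin] at this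
    · rw [if_neg hg]
      exact Or.inl ⟨rfl, by omega⟩
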